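/- Let $L$ be a completely regular frame and let $\mathcal{R}L$ be the ring of real-valued continuous functions on $L$, i.e. of the frame homomorphisms $\mathcal{L}(\mathbb{R})\to L$, where the frame of reals $\mathcal{L}(\mathbb{R})$ is generated by the pairs $(p,q)$ of rationals subject to $(p,q)\wedge(r,s)=(p\vee r,q\wedge s)$; $(p,q)\vee(r,s)=(p,s)$ whenever $p\le r<q\le s$; $(p,q)=\bigvee\{(r,s)\mid p<r<s<q\}$; and $1=\bigvee\{(p,q)\mid p,q\in\mathbb{Q}\}$. Sum and product ($\diamond\in\{+,\cdot\}$) are given by $(\varphi\diamond\psi)(p,q)=\bigvee\{\varphi(r,s)\wedge\psi(t,u)\mid \langle r,s\rangle\diamond\langle t,u\rangle\subseteq\langle p,q\rangle\}$, where $\langle r,s\rangle=\{x\in\mathbb{Q}\mid r<x<s\}$. For $\varphi\in\mathcal{R}L$ put $\operatorname{coz}\varphi=\bigvee\{\varphi(p,0)\vee\varphi(0,q)\mid p,q\in\mathbb{Q}\}$; the elements of this form are the cozero elements of $L$. Write $a^*$ for the pseudocomplement of $a\in L$. The frame $L$ is a $P_F$-frame if, whenever $a,b\in L$ are cozero elements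 with $a\wedge b=0$, at least one of $a,b$ is complemented in $L$. An ideal $I$ of $\mathcal{R}L$ is a $d$-ideal if for all $\alpha\in\mathcal{R}L$ and $f\in I$, $\operatorname{coz}\alpha\le(\operatorname{coz}f)^{**}$ implies $\alpha\in I$. The following statements are equivalent. 1. The sum of any two $d$-ideals of $\mathcal{R}L$ is a $d$-ideal or all of $\mathcal{R}L$, and of any two ideals of $\mathcal{R}L$ whose sum is a proper $d$-ideal, at least one is a $d$-ideal. 2. $L$ is a $P_F$-frame. 3. Of any two ideals of $\mathcal{R}L$ whose intersection is a $d$-ideal, at least one is a $d$-ideal. -/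

import Mathlib

open TopologicalSpace

namespace PointfreeReal

universe u

/-! ### Frames: complete regularity -/

/-- `a` is rather below `b`: some `t` has `a ∧ t = 0` and `t ∨ b = 1`. -/
def RatherBelow {L : Type u} [Order.Frame L] (a b : L) : Prop :=
  ∃ t : L, a ⊓ t = ⊥ ∧ t ⊔ b = ⊤

/-- `a` is completely below `b`: there is a family `c` indexed by the rationals in `[0, 1]` with
`c 0 = a`, `c 1 = b` and `c r` rather below `c s` whenever `r < s`. -/
def CompletelyBelow {L : Type u} [Order.Frame L] (a b : L) : Prop :=
  ∃ c : Set.Icc (0 : ℚ) 1 → L, c 0 = a ∧ c 1 = b ∧ ∀ r s, r < s → RatherBelow (c r) (c s)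

/-- A frame is completely regular if each element is the join of those completely below it. -/
def IsCompletelyRegular (L : Type u) [Order.Frame L] : Prop :=
  ∀ a : L, a = sSup {x : L | CompletelyBelow x a}

/-! ### Real-valued continuous functions on a frame -/

/-- The underlying set of `ℛL`.  The frame of reals is the frame generated by the pairs `(p, q)`
of rationals subject to the four relations below, so that a frame homomorphism from it to `L` is
precisely a map `ℚ × ℚ → L` that respects these relations. -/
@[ext]
structure RL (L : Type u) [Order.Frame L] where
  /-- the value at the generator `(p, q)` -/
  toFun : ℚ → ℚ → L
  inf_eq : ∀ p q r s, toFun p q ⊓ toFun r s = toFun (max p r) (min q s)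
  sup_eq : ∀ p q r s, p ≤ r → r < q → q ≤ s → toFun p q ⊔ toFun r s = toFun p s
  eq_iSup : ∀ p q, toFun p q = ⨆ (r : ℚ) (s : ℚ) (_ : p < r ∧ r < s ∧ s < q), toFun r s
  iSup_eq : ⨆ (p : ℚ) (q : ℚ), toFun p q = ⊤

/-! ### Frame homomorphisms on open sets

The frame of reals is isomorphic to `Opens ℝ`; this is used to verify the ring laws of `ℛL`. -/

section homs

variable {L : Type u} [Order.Frame L] {X Y : Type} [TopologicalSpace X] [TopologicalSpace Y]

/-- The product of two open sets. -/
def box (U : Opens X) (V : Opens Y) : Opens (X × Y) := ⟨U ×ˢ V, U.isOpen.prod V.isOpen⟩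

theorem le_sSup_box [LocallyCompactSpace X] (φ : FrameHom (Opens X) L) (ψ : FrameHom (Opens Y) L)
    (U : Opens X) (V : Opens Y) (S : Set (Opens (X × Y))) (h : box U V ≤ sSup S) (T : L)
    (hT : ∀ W ∈ S, ∀ A B, box A B ≤ W → φ A ⊓ ψ B ≤ T) : φ U ⊓ ψ V ≤ T := by
  have hU : U = sSup {A : Opens X | ∃ K : Set X, IsCompact K ∧ (A : Set X) ⊆ K ∧ K ⊆ U} := by
    apply le_antisymm
    · intro x hx
      obtain ⟨K, hK, hxK, hKU⟩ := exists_compact_subset U.isOpen hx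
      rw [Opens.mem_sSup]
      exact ⟨⟨interior K, isOpen_interior⟩, ⟨K, hK, interior_subset, hKU⟩, hxK⟩
    · apply sSup_le
      rintro A ⟨K, -, h1, h2⟩
      exact h1.trans h2
  rw [hU, map_sSup, sSup_inf_eq]
  apply iSup₂_le
  rintro _ ⟨A, ⟨K, hK, hAK, hKU⟩, rfl⟩
  -- vary the second coordinate
  have hV : V ≤ sSup {B : Opens Y | φ A ⊓ ψ B ≤ T} := by
    intro y hy
    rw [Opens.mem_sSup]
    have key : ∃ B : Opens Y, y ∈ B ∧ ∃ C : Opens X, K ⊆ C ∧ φ C ⊓ ψ B ≤ T := by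
      refine hK.induction_on (p := fun K => ∃ B : Opens Y, y ∈ B ∧ ∃ C : Opens X, K ⊆ C ∧
        φ C ⊓ ψ B ≤ T) ?_ ?_ ?_ ?_
      · exact ⟨⊤, trivial, ⊥, by simp, by simp⟩
      · rintro s t hst ⟨B, hB, C, hC, h⟩
        exact ⟨B, hB, C, hst.trans hC, h⟩
      · rintro s t ⟨B, hB, C, hC, h⟩ ⟨B', hB', C', hC', h'⟩
        refine ⟨B ⊓ B', ⟨hB, hB'⟩, C ⊔ C', ?_, ?_⟩
        · rw [Opens.coe_sup]; exact Set.union_subset_union hC hC'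
        · rw [map_sup, inf_sup_right]
          exact sup_le ((inf_le_inf_left _ (OrderHomClass.mono ψ inf_le_left)).trans h)
            ((inf_le_inf_left _ (OrderHomClass.mono ψ inf_le_right)).trans h')
      · intro x hx
        have hxy : (x, y) ∈ sSup S := h (show (x, y) ∈ (U : Set X) ×ˢ (V : Set Y) from ⟨hKU hx, hy⟩)
        rw [Opens.mem_sSup] at hxy
        obtain ⟨W, hW, hxW⟩ := hxy
        obtain ⟨A', B', hA', hB', hxA, hyB, hAB⟩ := isOpen_prod_iff.1 W.isOpen x y hxW
        exact ⟨A', mem_nhdsWithin_of_mem_nhds (hA'.mem_nhds hxA), ⟨B', hB'⟩, hyB, ⟨A', hA'⟩,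
          subset_rfl, hT W hW _ _ hAB⟩
    obtain ⟨B, hyB, C, hKC, h⟩ := key
    exact ⟨B, (inf_le_inf_right _ (OrderHomClass.mono φ (hAK.trans hKC : A ≤ C))).trans h, hyB⟩
  refine (inf_le_inf_left _ (OrderHomClass.mono ψ hV)).trans ?_
  rw [map_sSup, inf_sSup_eq]
  apply iSup₂_le
  rintro _ ⟨B, hB, rfl⟩
  exact hB

/-- The frame homomorphism on `Opens (X × Y)` induced by homomorphisms on the two factors. -/
def pair [LocallyCompactSpace X] (φ : FrameHom (Opens X) L) (ψ : FrameHom (Opens Y) L) :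
    FrameHom (Opens (X × Y)) L where
  toFun W := ⨆ (A : Opens X) (B : Opens Y) (_ : box A B ≤ W), φ A ⊓ ψ B
  map_inf' W W' := by
    apply le_antisymm
    · refine iSup_le fun A => iSup_le fun B => iSup_le fun h => le_inf ?_ ?_
      · exact le_iSup_of_le A (le_iSup_of_le B (le_iSup_of_le (h.trans inf_le_left) le_rfl))
      · exact le_iSup_of_le A (le_iSup_of_le B (le_iSup_of_le (h.trans inf_le_right) le_rfl))
    · simp only [iSup_inf_eq, inf_iSup_eq]
      refine iSup_le fun A => iSup_le fun B => iSup_le fun h => iSup_le fun A' => iSup_le fun B' =>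
        iSup_le fun h' => ?_
      refine le_iSup_of_le (A ⊓ A') (le_iSup_of_le (B ⊓ B') (le_iSup_of_le ?_ ?_))
      · rintro ⟨x, y⟩ ⟨⟨h1, h2⟩, h3, h4⟩
        exact ⟨h' (show (x, y) ∈ (A' : Set X) ×ˢ (B' : Set Y) from ⟨h2, h4⟩),
          h (show (x, y) ∈ (A : Set X) ×ˢ (B : Set Y) from ⟨h1, h3⟩)⟩
      · rw [map_inf, map_inf, inf_inf_inf_comm, inf_comm (φ A'), inf_comm (ψ B'),
          inf_inf_inf_comm, inf_inf_inf_comm]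
  map_top' := by
    rw [eq_top_iff]
    exact le_iSup_of_le ⊤ (le_iSup_of_le ⊤ (le_iSup_of_le le_top (by simp)))
  map_sSup' S := by
    apply le_antisymm
    · refine iSup_le fun A => iSup_le fun B => iSup_le fun h => ?_
      refine le_sSup_box φ ψ A B S h _ fun W hW A' B' h' => ?_
      exact le_sSup_of_le ⟨W, hW, rfl⟩
        (le_iSup_of_le A' (le_iSup_of_le B' (le_iSup_of_le h' le_rfl)))
    · apply sSup_le
      rintro _ ⟨W, hW, rfl⟩
      refine iSup_le fun A => iSup_le fun B => iSup_le fun h => ?_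
      exact le_iSup_of_le A (le_iSup_of_le B (le_iSup_of_le (h.trans (le_sSup hW)) le_rfl))

theorem pair_apply [LocallyCompactSpace X] (φ : FrameHom (Opens X) L) (ψ : FrameHom (Opens Y) L)
    (W : Opens (X × Y)) :
    pair φ ψ W = ⨆ (A : Opens X) (B : Opens Y) (_ : box A B ≤ W), φ A ⊓ ψ B := rfl

/-- A homomorphism on `Opens (X × Y)` is determined by its restrictions to the factors. -/
theorem pair_comap [LocallyCompactSpace X] (H : FrameHom (Opens (X × Y)) L) :
    pair (H.comp (Opens.comap ⟨Prod.fst, continuous_fst⟩))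
      (H.comp (Opens.comap ⟨Prod.snd, continuous_snd⟩)) = H := by
  have hb : ∀ (A : Opens X) (B : Opens Y), (H.comp (Opens.comap ⟨Prod.fst, continuous_fst⟩)) A ⊓
      (H.comp (Opens.comap ⟨Prod.snd, continuous_snd⟩)) B = H (box A B) := by
    intro A B
    simp only [FrameHom.comp_apply]
    rw [← map_inf]
    rfl
  ext W
  rw [pair_apply]
  simp only [hb]
  apply le_antisymm
  · exact iSup_le fun A => iSup_le fun B => iSup_le fun h => OrderHomClass.mono H h
  · have hW : W ≤ ⨆ (A : Opens X) (B : Opens Y) (_ : box A B ≤ W), box A B := by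
      rintro ⟨x, y⟩ hxy
      obtain ⟨A', B', hA', hB', hxA, hyB, hAB⟩ := isOpen_prod_iff.1 W.isOpen x y hxy
      have : box ⟨A', hA'⟩ ⟨B', hB'⟩ ≤ ⨆ (A : Opens X) (B : Opens Y) (_ : box A B ≤ W), box A B :=
        le_iSup_of_le (⟨A', hA'⟩ : Opens X) (le_iSup_of_le (⟨B', hB'⟩ : Opens Y)
          (le_iSup_of_le hAB le_rfl))
      exact this (show (x, y) ∈ A' ×ˢ B' from ⟨hxA, hyB⟩)
    refine (OrderHomClass.mono H hW).trans ?_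
    simp only [map_iSup]
    exact le_rfl

theorem pair_fst [LocallyCompactSpace X] (φ : FrameHom (Opens X) L) (ψ : FrameHom (Opens Y) L) :
    (pair φ ψ).comp (Opens.comap ⟨Prod.fst, continuous_fst⟩) = φ := by
  ext U
  apply le_antisymm
  · rw [FrameHom.comp_apply, pair_apply]
    refine iSup_le fun A => iSup_le fun B => iSup_le fun h => ?_
    rcases (B : Set Y).eq_empty_or_nonempty with hB | ⟨y, hy⟩
    · have : B = ⊥ := Opens.ext hB
      simp [this]
    · refine inf_le_left.trans (OrderHomClass.mono φ fun x hx => ?_)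
      exact h (show (x, y) ∈ (A : Set X) ×ˢ (B : Set Y) from ⟨hx, hy⟩)
  · rw [FrameHom.comp_apply, pair_apply]
    refine le_iSup_of_le U (le_iSup_of_le ⊤ (le_iSup_of_le (fun x hx => hx.1) (by simp)))

theorem pair_snd [LocallyCompactSpace X] (φ : FrameHom (Opens X) L) (ψ : FrameHom (Opens Y) L) :
    (pair φ ψ).comp (Opens.comap ⟨Prod.snd, continuous_snd⟩) = ψ := by
  ext U
  apply le_antisymm
  · rw [FrameHom.comp_apply, pair_apply]
    refine iSup_le fun A => iSup_le fun B => iSup_le fun h => ?_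
    rcases (A : Set X).eq_empty_or_nonempty with hA | ⟨x, hx⟩
    · have : A = ⊥ := Opens.ext hA
      simp [this]
    · refine inf_le_right.trans (OrderHomClass.mono ψ fun y hy => ?_)
      exact h (show (x, y) ∈ (A : Set X) ×ˢ (B : Set Y) from ⟨hx, hy⟩)
  · rw [FrameHom.comp_apply, pair_apply]
    refine le_iSup_of_le ⊤ (le_iSup_of_le U (le_iSup_of_le (fun x hx => hx.2) (by simp)))

/-- The binary operation on homomorphisms induced by a continuous operation on `ℝ`. -/
def op (g : C(ℝ × ℝ, ℝ)) (φ ψ : FrameHom (Opens ℝ) L) : FrameHom (Opens ℝ) L :=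
  (pair φ ψ).comp (Opens.comap g)

theorem op_comap (g : C(ℝ × ℝ, ℝ)) (T : FrameHom (Opens X) L) (a b : C(X, ℝ)) :
    op g (T.comp (Opens.comap a)) (T.comp (Opens.comap b)) =
      T.comp (Opens.comap (g.comp (a.prodMk b))) := by
  have h := pair_comap (T.comp (Opens.comap (a.prodMk b)))
  have ha : (T.comp (Opens.comap (a.prodMk b))).comp (Opens.comap ⟨Prod.fst, continuous_fst⟩)
      = T.comp (Opens.comap a) := rfl
  have hb : (T.comp (Opens.comap (a.prodMk b))).comp (Opens.comap ⟨Prod.snd, continuous_snd⟩)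
      = T.comp (Opens.comap b) := rfl
  rw [ha, hb] at h
  rw [op, h]
  rfl

/-- Any three homomorphisms factor through one space. -/
theorem exists_common (φ ψ χ : FrameHom (Opens ℝ) L) :
    ∃ (T : FrameHom (Opens ((ℝ × ℝ) × ℝ)) L) (a b c : C((ℝ × ℝ) × ℝ, ℝ)),
      φ = T.comp (Opens.comap a) ∧ ψ = T.comp (Opens.comap b) ∧ χ = T.comp (Opens.comap c) := by
  refine ⟨pair (pair φ ψ) χ, ⟨fun x => x.1.1, by fun_prop⟩, ⟨fun x => x.1.2, by fun_prop⟩,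
    ⟨fun x => x.2, by fun_prop⟩, ?_, ?_, ?_⟩
  · have h := congrArg (fun H : FrameHom (Opens (ℝ × ℝ)) L =>
      H.comp (Opens.comap ⟨Prod.fst, continuous_fst⟩)) (pair_fst (pair φ ψ) χ)
    exact ((h.trans (pair_fst φ ψ))).symm
  · have h := congrArg (fun H : FrameHom (Opens (ℝ × ℝ)) L =>
      H.comp (Opens.comap ⟨Prod.snd, continuous_snd⟩)) (pair_fst (pair φ ψ) χ)
    exact ((h.trans (pair_snd φ ψ))).symm
  · exact (pair_snd (pair φ ψ) χ).symm

end homs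

/-! ### Elements of `ℛL` and homomorphisms on `Opens ℝ` -/

/-- The open interval of reals with given rational endpoints. -/
def ival (p q : ℚ) : Opens ℝ := ⟨Set.Ioo (p : ℝ) q, isOpen_Ioo⟩

theorem mem_ival {p q : ℚ} {x : ℝ} : x ∈ ival p q ↔ (p : ℝ) < x ∧ x < q := Iff.rfl

theorem ival_le {p q r s : ℚ} (hrs : r < s) (h : ival r s ≤ ival p q) : p ≤ r ∧ s ≤ q := by
  have h' := (Set.Ioo_subset_Ioo_iff (show (r : ℝ) < s by exact_mod_cast hrs)).1
    (show Set.Ioo (r : ℝ) s ⊆ Set.Ioo (p : ℝ) q from h)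
  exact ⟨by exact_mod_cast h'.1, by exact_mod_cast h'.2⟩

theorem exists_ival (U : Opens ℝ) {x : ℝ} (hx : x ∈ U) :
    ∃ p q : ℚ, x ∈ ival p q ∧ ival p q ≤ U := by
  obtain ⟨a, b, ⟨ha, hb⟩, hab⟩ := mem_nhds_iff_exists_Ioo_subset.1 (U.isOpen.mem_nhds hx)
  obtain ⟨p, hp1, hp2⟩ := exists_rat_btwn ha
  obtain ⟨q, hq1, hq2⟩ := exists_rat_btwn hb
  exact ⟨p, q, ⟨hp2, hq1⟩, fun y hy => hab ⟨hp1.trans hy.1, hy.2.trans hq2⟩⟩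

theorem eq_iSup_ival (U : Opens ℝ) : U = ⨆ (p : ℚ) (q : ℚ) (_ : ival p q ≤ U), ival p q := by
  apply le_antisymm
  · intro x hx
    obtain ⟨p, q, hxpq, h⟩ := exists_ival U hx
    have : ival p q ≤ ⨆ (p : ℚ) (q : ℚ) (_ : ival p q ≤ U), ival p q :=
      le_iSup_of_le p (le_iSup_of_le q (le_iSup_of_le h le_rfl))
    exact this hxpq
  · exact iSup_le fun p => iSup_le fun q => iSup_le fun h => h

namespace RL

variable {L : Type u} [Order.Frame L]

/-- Restriction of a homomorphism on `Opens ℝ` to the rational intervals. -/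
def ofHom (H : FrameHom (Opens ℝ) L) : RL L where
  toFun p q := H (ival p q)
  inf_eq p q r s := by
    rw [← map_inf]
    congr 1
    apply Opens.ext
    simp [ival, Set.Ioo_inter_Ioo]
  sup_eq p q r s h1 h2 h3 := by
    rw [← map_sup]
    congr 1
    have h1' : (p : ℝ) ≤ r := by exact_mod_cast h1
    have h2' : (r : ℝ) < q := by exact_mod_cast h2
    have h3' : (q : ℝ) ≤ s := by exact_mod_cast h3
    apply Opens.ext
    ext x
    simp only [ival, Opens.coe_sup, Opens.coe_mk, Set.mem_union, Set.mem_Ioo]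
    constructor
    · rintro (⟨ha, hb⟩ | ⟨ha, hb⟩)
      · exact ⟨ha, hb.trans_le h3'⟩
      · exact ⟨h1'.trans_lt ha, hb⟩
    · rintro ⟨ha, hb⟩
      rcases lt_or_ge x q with h | h
      · exact Or.inl ⟨ha, h⟩
      · exact Or.inr ⟨h2'.trans_le h, hb⟩
  eq_iSup p q := by
    simp only [← map_iSup]
    congr 1
    apply le_antisymm
    · rintro x ⟨hx1, hx2⟩
      obtain ⟨r, hr1, hr2⟩ := exists_rat_btwn hx1
      obtain ⟨s, hs1, hs2⟩ := exists_rat_btwn hx2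
      have : ival r s ≤ ⨆ (r : ℚ) (s : ℚ) (_ : p < r ∧ r < s ∧ s < q), ival r s :=
        le_iSup_of_le r (le_iSup_of_le s (le_iSup_of_le
          ⟨by exact_mod_cast hr1, by exact_mod_cast hr2.trans hs1, by exact_mod_cast hs2⟩ le_rfl))
      exact this ⟨hr2, hs1⟩
    · refine iSup_le fun r => iSup_le fun s => iSup_le fun h => ?_
      rintro x ⟨hx1, hx2⟩
      exact ⟨lt_trans (by exact_mod_cast h.1) hx1, lt_trans hx2 (by exact_mod_cast h.2.2)⟩
  iSup_eq := by
    simp only [← map_iSup]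
    rw [← map_top H]
    congr 1
    rw [eq_top_iff]
    refine (eq_iSup_ival ⊤).le.trans ?_
    simp

theorem mono (φ : RL L) {p q r s : ℚ} (h1 : p ≤ r) (h2 : s ≤ q) : φ.toFun r s ≤ φ.toFun p q := by
  have := φ.inf_eq p q r s
  rw [max_eq_right h1, min_eq_right h2] at this
  exact inf_eq_right.1 this

theorem eq_bot (φ : RL L) {p q : ℚ} (h : q ≤ p) : φ.toFun p q = ⊥ := by
  rw [φ.eq_iSup, eq_bot_iff]
  refine iSup_le fun r => iSup_le fun s => iSup_le fun h' => ?_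
  exact absurd (h'.1.trans (h'.2.1.trans h'.2.2)) (not_lt.2 h)

theorem le_of_ival_le (φ : RL L) {p q r s : ℚ} (h : ival r s ≤ ival p q) :
    φ.toFun r s ≤ φ.toFun p q := by
  rcases lt_or_ge r s with hrs | hrs
  · exact φ.mono (ival_le hrs h).1 (ival_le hrs h).2
  · rw [φ.eq_bot hrs]; exact bot_le

theorem le_of_small (φ : RL L) {r s h : ℚ} (hh : 0 < h) (T : L)
    (hT : ∀ p q, r ≤ p → p < q → q ≤ s → q - p ≤ h → φ.toFun p q ≤ T) (n : ℕ) :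
    ∀ p q, r ≤ p → q ≤ s → q - p ≤ n * (h / 2) → φ.toFun p q ≤ T := by
  induction n with
  | zero =>
    intro p q _ _ h3
    rw [φ.eq_bot (by simpa using h3)]
    exact bot_le
  | succ n ih =>
    intro p q h1 h2 h3
    rcases le_or_gt q p with hqp | hpq
    · rw [φ.eq_bot hqp]; exact bot_le
    rcases le_or_gt (q - p) h with hs | hs
    · exact hT p q h1 hpq h2 hs
    rw [← φ.sup_eq p (p + h) (p + h / 2) q (by linarith) (by linarith) (by linarith)]
    apply sup_le
    · exact hT _ _ h1 (by linarith) (by linarith) (by linarith)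
    · apply ih _ _ (by linarith) h2
      push_cast at h3
      linarith

theorem le_of_cover (φ : RL L) (S : Set (Opens ℝ)) {p q : ℚ} (h : ival p q ≤ sSup S) (T : L)
    (hT : ∀ U ∈ S, ∀ r s, ival r s ≤ U → φ.toFun r s ≤ T) : φ.toFun p q ≤ T := by
  rw [φ.eq_iSup]
  refine iSup_le fun r => iSup_le fun s => iSup_le fun hrs => ?_
  have hr : (p : ℝ) < r := by exact_mod_cast hrs.1
  have hs : (s : ℝ) < q := by exact_mod_cast hrs.2.2
  obtain ⟨δ, hδ, hball⟩ := lebesgue_number_lemma_of_metric_sUnion (s := Set.Icc (r : ℝ) s)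
    (c := (fun U : Opens ℝ => (U : Set ℝ)) '' S) isCompact_Icc
    (by rintro _ ⟨U, -, rfl⟩; exact U.isOpen)
    (by
      intro x hx
      have hx' : x ∈ sSup S := h ⟨hr.trans_le hx.1, hx.2.trans_lt hs⟩
      rw [Opens.mem_sSup] at hx'
      obtain ⟨U, hU, hxU⟩ := hx'
      exact ⟨U, ⟨U, hU, rfl⟩, hxU⟩)
  obtain ⟨d, hd0, hd⟩ := exists_rat_btwn hδ
  have hd0' : 0 < d := by exact_mod_cast hd0
  obtain ⟨n, hn⟩ := exists_nat_gt ((s - r) / (d / 2))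
  refine φ.le_of_small (r := r) (s := s) hd0' T ?_ n r s le_rfl le_rfl ?_
  · intro a b ha hab hb hd'
    have ha' : (r : ℝ) ≤ a := by exact_mod_cast ha
    have hab' : (a : ℝ) < b := by exact_mod_cast hab
    have hb' : (b : ℝ) ≤ s := by exact_mod_cast hb
    have hd'' : (b : ℝ) - a ≤ d := by exact_mod_cast hd'
    obtain ⟨_, ⟨U, hU, rfl⟩, hsub⟩ := hball a ⟨ha', by linarith⟩
    refine hT U hU a b fun x hx => hsub ?_
    rw [Metric.mem_ball, Real.dist_eq, abs_lt]
    have := hx.1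
    have := hx.2
    constructor <;> linarith
  · rw [div_lt_iff₀ (by positivity)] at hn
    exact hn.le

/-- Extension of an element of `ℛL` to a frame homomorphism on `Opens ℝ`. -/
def toHom (φ : RL L) : FrameHom (Opens ℝ) L where
  toFun U := ⨆ (p : ℚ) (q : ℚ) (_ : ival p q ≤ U), φ.toFun p q
  map_inf' U V := by
    apply le_antisymm
    · refine iSup_le fun p => iSup_le fun q => iSup_le fun h => le_inf ?_ ?_
      · exact le_iSup_of_le p (le_iSup_of_le q (le_iSup_of_le (h.trans inf_le_left) le_rfl))
      · exact le_iSup_of_le p (le_iSup_of_le q (le_iSup_of_le (h.trans inf_le_right) le_rfl))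
    · simp only [iSup_inf_eq, inf_iSup_eq]
      refine iSup_le fun p => iSup_le fun q => iSup_le fun h => iSup_le fun r => iSup_le fun s =>
        iSup_le fun h' => ?_
      refine le_iSup_of_le _ (le_iSup_of_le _ (le_iSup_of_le ?_ (φ.inf_eq _ _ _ _).le))
      rintro x ⟨hx1, hx2⟩
      push_cast at hx1 hx2
      rw [max_lt_iff] at hx1
      rw [lt_min_iff] at hx2
      exact ⟨h' ⟨hx1.1, hx2.1⟩, h ⟨hx1.2, hx2.2⟩⟩
  map_top' := by
    simp only [le_top, iSup_pos]
    exact φ.iSup_eq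
  map_sSup' S := by
    apply le_antisymm
    · refine iSup_le fun p => iSup_le fun q => iSup_le fun h => ?_
      refine φ.le_of_cover S h _ fun U hU r s h' => ?_
      exact le_sSup_of_le ⟨U, hU, rfl⟩
        (le_iSup_of_le r (le_iSup_of_le s (le_iSup_of_le h' le_rfl)))
    · apply sSup_le
      rintro _ ⟨U, hU, rfl⟩
      refine iSup_le fun p => iSup_le fun q => iSup_le fun h => ?_
      exact le_iSup_of_le p (le_iSup_of_le q (le_iSup_of_le (h.trans (le_sSup hU)) le_rfl))

theorem toHom_apply (φ : RL L) (U : Opens ℝ) :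
    φ.toHom U = ⨆ (p : ℚ) (q : ℚ) (_ : ival p q ≤ U), φ.toFun p q := rfl

theorem toHom_ival (φ : RL L) (p q : ℚ) : φ.toHom (ival p q) = φ.toFun p q := by
  apply le_antisymm
  · exact iSup_le fun r => iSup_le fun s => iSup_le fun h => φ.le_of_ival_le h
  · exact le_iSup_of_le p (le_iSup_of_le q (le_iSup_of_le le_rfl le_rfl))

theorem ofHom_toHom (φ : RL L) : ofHom φ.toHom = φ := by
  ext p q
  exact φ.toHom_ival p q

theorem toHom_ofHom (H : FrameHom (Opens ℝ) L) : (ofHom H).toHom = H := by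
  ext U
  conv_rhs => rw [eq_iSup_ival U]
  simp only [map_iSup]
  rfl

theorem toHom_injective : Function.Injective (toHom : RL L → FrameHom (Opens ℝ) L) :=
  Function.LeftInverse.injective ofHom_toHom

/-! ### The ring operations -/

/-- The value `(φ ◇ ψ)(p, q) = ⋁ {φ(r, s) ∧ ψ(t, u) | ⟨r, s⟩ ◇ ⟨t, u⟩ ⊆ ⟨p, q⟩}`, where `⟨r, s⟩` is
the set of rationals strictly between `r` and `s`. -/
def opVal (o : ℚ → ℚ → ℚ) (φ ψ : RL L) (p q : ℚ) : L :=
  ⨆ (r : ℚ) (s : ℚ) (t : ℚ) (v : ℚ)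
    (_ : ∀ x ∈ Set.Ioo r s, ∀ y ∈ Set.Ioo t v, o x y ∈ Set.Ioo p q), φ.toFun r s ⊓ ψ.toFun t v

theorem opVal_eq (o : ℚ → ℚ → ℚ) (g : C(ℝ × ℝ, ℝ)) (hg : ∀ x y : ℚ, g (x, y) = (o x y : ℚ))
    (hb : ∀ (x y : ℝ) (a b c d : ℚ), (a : ℝ) < x → x < b → (c : ℝ) < y → y < d →
      g (x, y) ∈ convexHull ℝ {g (a, c), g (a, d), g (b, c), g (b, d)})
    (φ ψ : RL L) (p q : ℚ) : opVal o φ ψ p q = op g φ.toHom ψ.toHom (ival p q) := by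
  apply le_antisymm
  · refine iSup_le fun r => iSup_le fun s => iSup_le fun t => iSup_le fun v => iSup_le fun h => ?_
    rw [op, FrameHom.comp_apply, pair_apply]
    refine le_iSup_of_le (ival r s) (le_iSup_of_le (ival t v) (le_iSup_of_le ?_ ?_))
    · rintro ⟨x, y⟩ ⟨⟨hx1, hx2⟩, hy1, hy2⟩
      obtain ⟨a, ha1, ha2⟩ := exists_rat_btwn hx1
      obtain ⟨b, hb1, hb2⟩ := exists_rat_btwn hx2
      obtain ⟨c, hc1, hc2⟩ := exists_rat_btwn hy1
      obtain ⟨d, hd1, hd2⟩ := exists_rat_btwn hy2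
      dsimp only at ha2 hb1 hc2 hd1
      have ha : a ∈ Set.Ioo r s :=
        ⟨by exact_mod_cast ha1, by exact_mod_cast ha2.trans (hb1.trans hb2)⟩
      have hb' : b ∈ Set.Ioo r s :=
        ⟨by exact_mod_cast ha1.trans (ha2.trans hb1), by exact_mod_cast hb2⟩
      have hc : c ∈ Set.Ioo t v :=
        ⟨by exact_mod_cast hc1, by exact_mod_cast hc2.trans (hd1.trans hd2)⟩
      have hd : d ∈ Set.Ioo t v :=
        ⟨by exact_mod_cast hc1.trans (hc2.trans hd1), by exact_mod_cast hd2⟩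
      have key : ∀ x ∈ Set.Ioo r s, ∀ y ∈ Set.Ioo t v, g (x, y) ∈ Set.Ioo (p : ℝ) q := by
        intro x hx y hy
        rw [hg]
        exact ⟨by exact_mod_cast (h x hx y hy).1, by exact_mod_cast (h x hx y hy).2⟩
      refine convexHull_min ?_ (convex_Ioo (p : ℝ) q) (hb x y a b c d ha2 hb1 hc2 hd1)
      rintro z (rfl | rfl | rfl | rfl)
      · exact key a ha c hc
      · exact key a ha d hd
      · exact key b hb' c hc
      · exact key b hb' d hd
    · rw [toHom_ival, toHom_ival]
  · rw [op, FrameHom.comp_apply, pair_apply]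
    refine iSup_le fun A => iSup_le fun B => iSup_le fun h => ?_
    rw [toHom_apply, toHom_apply]
    simp only [iSup_inf_eq, inf_iSup_eq]
    refine iSup_le fun r => iSup_le fun s => iSup_le fun hA => iSup_le fun t => iSup_le fun v =>
      iSup_le fun hB => ?_
    have fin : ∀ r s t v : ℚ, ival r s ≤ A → ival t v ≤ B →
        φ.toFun r s ⊓ ψ.toFun t v ≤ opVal o φ ψ p q := by
      intro r s t v hA hB
      refine le_iSup_of_le r (le_iSup_of_le s (le_iSup_of_le t (le_iSup_of_le v
        (le_iSup_of_le ?_ le_rfl))))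
      rintro x ⟨hx1, hx2⟩ y ⟨hy1, hy2⟩
      have hx : (x : ℝ) ∈ A := hA ⟨by exact_mod_cast hx1, by exact_mod_cast hx2⟩
      have hy : (y : ℝ) ∈ B := hB ⟨by exact_mod_cast hy1, by exact_mod_cast hy2⟩
      have hxy : g ((x : ℝ), (y : ℝ)) ∈ Set.Ioo (p : ℝ) q :=
        h (show ((x : ℝ), (y : ℝ)) ∈ (A : Set ℝ) ×ˢ (B : Set ℝ) from ⟨hx, hy⟩)
      rw [hg] at hxy
      exact ⟨by exact_mod_cast hxy.1, by exact_mod_cast hxy.2⟩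
    exact fin t v r s hB hA

/-- Addition on `ℝ` as a continuous map. -/
def addMap : C(ℝ × ℝ, ℝ) := ⟨fun x => x.1 + x.2, by fun_prop⟩

/-- Multiplication on `ℝ` as a continuous map. -/
def mulMap : C(ℝ × ℝ, ℝ) := ⟨fun x => x.1 * x.2, by fun_prop⟩

theorem bilin_mem (g : ℝ → ℝ → ℝ)
    (h1 : ∀ y a b s t : ℝ, s + t = 1 → g (s * a + t * b) y = s * g a y + t * g b y)
    (h2 : ∀ x a b s t : ℝ, s + t = 1 → g x (s * a + t * b) = s * g x a + t * g x b)
    (x y a b c d : ℝ) (ha : a < x) (hb : x < b) (hc : c < y) (hd : y < d) :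
    g x y ∈ convexHull ℝ {g a c, g a d, g b c, g b d} := by
  have hconv := convex_convexHull ℝ ({g a c, g a d, g b c, g b d} : Set ℝ)
  have hsub := subset_convexHull ℝ ({g a c, g a d, g b c, g b d} : Set ℝ)
  obtain ⟨s, t, hs, ht, hst, hx⟩ : x ∈ segment ℝ a b := by
    rw [segment_eq_Icc (ha.trans hb).le]; exact ⟨ha.le, hb.le⟩
  obtain ⟨s', t', hs', ht', hst', hy⟩ : y ∈ segment ℝ c d := by
    rw [segment_eq_Icc (hc.trans hd).le]; exact ⟨hc.le, hd.le⟩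
  simp only [smul_eq_mul] at hx hy
  rw [← hx, h1 _ _ _ _ _ hst]
  refine hconv ?_ ?_ hs ht hst
  · rw [← hy, h2 _ _ _ _ _ hst']
    exact hconv (hsub (by simp)) (hsub (by simp)) hs' ht' hst'
  · rw [← hy, h2 _ _ _ _ _ hst']
    exact hconv (hsub (by simp)) (hsub (by simp)) hs' ht' hst'

theorem opVal_add (φ ψ : RL L) :
    opVal (· + ·) φ ψ = (ofHom (op addMap φ.toHom ψ.toHom)).toFun := by
  funext p q
  refine opVal_eq _ addMap (fun x y => by simp [addMap]) ?_ φ ψ p q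
  intro x y a b c d ha hb hc hd
  refine bilin_mem (fun x y => x + y) ?_ ?_ x y a b c d ha hb hc hd
  · intro y a b s t h
    linear_combination (-y) * h
  · intro y a b s t h
    linear_combination (-y) * h

theorem opVal_mul (φ ψ : RL L) :
    opVal (· * ·) φ ψ = (ofHom (op mulMap φ.toHom ψ.toHom)).toFun := by
  funext p q
  refine opVal_eq _ mulMap (fun x y => by simp [mulMap]) ?_ φ ψ p q
  intro x y a b c d ha hb hc hd
  refine bilin_mem (fun x y => x * y) ?_ ?_ x y a b c d ha hb hc hd
  · intro y a b s t _
    ring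
  · intro y a b s t _
    ring

/-- `(φ + ψ)(p, q) = ⋁ {φ(r, s) ∧ ψ(t, u) | ⟨r, s⟩ + ⟨t, u⟩ ⊆ ⟨p, q⟩}` -/
instance : Add (RL L) where
  add φ ψ :=
    { toFun := opVal (· + ·) φ ψ
      inf_eq := by rw [opVal_add]; exact (ofHom _).inf_eq
      sup_eq := by rw [opVal_add]; exact (ofHom _).sup_eq
      eq_iSup := by rw [opVal_add]; exact (ofHom _).eq_iSup
      iSup_eq := by rw [opVal_add]; exact (ofHom _).iSup_eq }

/-- `(φ ψ)(p, q) = ⋁ {φ(r, s) ∧ ψ(t, u) | ⟨r, s⟩ · ⟨t, u⟩ ⊆ ⟨p, q⟩}` -/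
instance : Mul (RL L) where
  mul φ ψ :=
    { toFun := opVal (· * ·) φ ψ
      inf_eq := by rw [opVal_mul]; exact (ofHom _).inf_eq
      sup_eq := by rw [opVal_mul]; exact (ofHom _).sup_eq
      eq_iSup := by rw [opVal_mul]; exact (ofHom _).eq_iSup
      iSup_eq := by rw [opVal_mul]; exact (ofHom _).iSup_eq }

theorem toHom_add (φ ψ : RL L) : (φ + ψ).toHom = op addMap φ.toHom ψ.toHom := by
  have : φ + ψ = ofHom (op addMap φ.toHom ψ.toHom) := RL.ext (opVal_add φ ψ)
  rw [this, toHom_ofHom]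

theorem toHom_mul (φ ψ : RL L) : (φ * ψ).toHom = op mulMap φ.toHom ψ.toHom := by
  have : φ * ψ = ofHom (op mulMap φ.toHom ψ.toHom) := RL.ext (opVal_mul φ ψ)
  rw [this, toHom_ofHom]

/-- Negation on `ℝ` as a continuous map. -/
def negMap : C(ℝ, ℝ) := ⟨fun x => -x, by fun_prop⟩

theorem neg_aux (φ : RL L) :
    (fun p q => φ.toFun (-q) (-p)) = (ofHom (φ.toHom.comp (Opens.comap negMap))).toFun := by
  funext p q
  rw [← toHom_ival]
  change φ.toHom _ = φ.toHom _
  congr 1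
  apply Opens.ext
  ext x
  simp only [ival, Opens.coe_mk, Rat.cast_neg, Set.mem_Ioo]
  change _ ↔ (p : ℝ) < -x ∧ -x < q
  constructor <;> rintro ⟨h1, h2⟩ <;> constructor <;> linarith

/-- `(-φ)(p, q) = φ(-q, -p)` -/
instance : Neg (RL L) where
  neg φ :=
    { toFun := fun p q => φ.toFun (-q) (-p)
      inf_eq := by
        have h := (ofHom (φ.toHom.comp (Opens.comap negMap))).inf_eq
        rw [← neg_aux] at h
        exact h
      sup_eq := by
        have h := (ofHom (φ.toHom.comp (Opens.comap negMap))).sup_eq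
        rw [← neg_aux] at h
        exact h
      eq_iSup := by
        have h := (ofHom (φ.toHom.comp (Opens.comap negMap))).eq_iSup
        rw [← neg_aux] at h
        exact h
      iSup_eq := by
        have h := (ofHom (φ.toHom.comp (Opens.comap negMap))).iSup_eq
        rw [← neg_aux] at h
        exact h }

theorem toHom_neg (φ : RL L) : (-φ).toHom = φ.toHom.comp (Opens.comap negMap) := by
  have : -φ = ofHom (φ.toHom.comp (Opens.comap negMap)) := RL.ext (neg_aux φ)
  rw [this, toHom_ofHom]

/-- The homomorphism on `Opens ℝ` concentrated at the real number `x`. -/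
noncomputable def pointHom (x : ℝ) : FrameHom (Opens ℝ) L where
  toFun U := ⨆ (_ : x ∈ U), ⊤
  map_inf' U V := by
    by_cases h1 : x ∈ U <;> by_cases h2 : x ∈ V <;> simp [h1, h2]
  map_top' := by simp
  map_sSup' S := by
    apply le_antisymm
    · refine iSup_le fun h => ?_
      rw [Opens.mem_sSup] at h
      obtain ⟨U, hU, hx⟩ := h
      exact le_sSup_of_le ⟨U, hU, rfl⟩ (le_iSup_of_le hx le_rfl)
    · apply sSup_le
      rintro _ ⟨U, hU, rfl⟩
      exact iSup_le fun h => le_iSup_of_le (Opens.mem_sSup.2 ⟨U, hU, h⟩) le_rfl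

theorem const_aux (c : ℚ) :
    (fun p q => ⨆ (_ : p < c ∧ c < q), (⊤ : L)) = (ofHom (pointHom (c : ℝ))).toFun := by
  funext p q
  change _ = ⨆ (_ : (c : ℝ) ∈ ival p q), (⊤ : L)
  simp [mem_ival]

/-- The constant function with rational value `c`: it takes `(p, q)` to `1` if `p < c < q`, and to
`0` otherwise. -/
def const (c : ℚ) : RL L where
  toFun p q := ⨆ (_ : p < c ∧ c < q), ⊤
  inf_eq := by
    have h := (ofHom (pointHom (c : ℝ)) : RL L).inf_eq
    rw [← const_aux] at h
    exact h
  sup_eq := by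
    have h := (ofHom (pointHom (c : ℝ)) : RL L).sup_eq
    rw [← const_aux] at h
    exact h
  eq_iSup := by
    have h := (ofHom (pointHom (c : ℝ)) : RL L).eq_iSup
    rw [← const_aux] at h
    exact h
  iSup_eq := by
    have h := (ofHom (pointHom (c : ℝ)) : RL L).iSup_eq
    rw [← const_aux] at h
    exact h

instance : Zero (RL L) := ⟨const 0⟩

instance : One (RL L) := ⟨const 1⟩

theorem toHom_const (c : ℚ) {X : Type} [TopologicalSpace X] (T : FrameHom (Opens X) L) :
    (const c : RL L).toHom = T.comp (Opens.comap (ContinuousMap.const X (c : ℝ))) := by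
  have : (const c : RL L) = ofHom (pointHom (c : ℝ)) := RL.ext (const_aux c)
  rw [this, toHom_ofHom]
  ext U
  change (⨆ (_ : (c : ℝ) ∈ U), (⊤ : L)) = T (Opens.comap (ContinuousMap.const X (c : ℝ)) U)
  by_cases h : (c : ℝ) ∈ U
  · have : Opens.comap (ContinuousMap.const X (c : ℝ)) U = ⊤ := by
      apply Opens.ext
      ext x
      simp [h]
    rw [this, map_top]
    simp [h]
  · have : Opens.comap (ContinuousMap.const X (c : ℝ)) U = ⊥ := by
      apply Opens.ext
      ext x
      simp [h]
    rw [this, map_bot]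
    simp [h]

/-- The ring laws are inherited from those of `C(X, ℝ)`. -/
theorem lift_eq (φ ψ χ : RL L) :
    ∃ (T : FrameHom (Opens ((ℝ × ℝ) × ℝ)) L) (a b c : C((ℝ × ℝ) × ℝ, ℝ)),
      φ = ofHom (T.comp (Opens.comap a)) ∧ ψ = ofHom (T.comp (Opens.comap b)) ∧
        χ = ofHom (T.comp (Opens.comap c)) := by
  obtain ⟨T, a, b, c, h1, h2, h3⟩ := exists_common φ.toHom ψ.toHom χ.toHom
  exact ⟨T, a, b, c, by rw [← h1, ofHom_toHom], by rw [← h2, ofHom_toHom],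
    by rw [← h3, ofHom_toHom]⟩

section pull

variable {X : Type} [TopologicalSpace X] (T : FrameHom (Opens X) L) (a b : C(X, ℝ))

theorem pull_add : (ofHom (T.comp (Opens.comap a)) + ofHom (T.comp (Opens.comap b)) : RL L) =
    ofHom (T.comp (Opens.comap (a + b))) := by
  apply toHom_injective
  rw [toHom_add, toHom_ofHom, toHom_ofHom, toHom_ofHom, op_comap]
  rfl

theorem pull_mul : (ofHom (T.comp (Opens.comap a)) * ofHom (T.comp (Opens.comap b)) : RL L) =
    ofHom (T.comp (Opens.comap (a * b))) := by
  apply toHom_injective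
  rw [toHom_mul, toHom_ofHom, toHom_ofHom, toHom_ofHom, op_comap]
  rfl

theorem pull_neg : (-ofHom (T.comp (Opens.comap a)) : RL L) =
    ofHom (T.comp (Opens.comap (-a))) := by
  apply toHom_injective
  rw [toHom_neg, toHom_ofHom, toHom_ofHom]
  rfl

theorem pull_zero : (0 : RL L) = ofHom (T.comp (Opens.comap 0)) := by
  apply toHom_injective
  rw [toHom_ofHom]
  refine (toHom_const 0 T).trans ?_
  congr 2
  ext x
  simp

theorem pull_one : (1 : RL L) = ofHom (T.comp (Opens.comap 1)) := by
  apply toHom_injective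
  rw [toHom_ofHom]
  refine (toHom_const 1 T).trans ?_
  congr 2
  ext x
  simp

end pull

/-- The ring `ℛL` of real-valued continuous functions on the frame `L`. -/
instance : CommRing (RL L) where
  add_assoc φ ψ χ := by
    obtain ⟨T, a, b, c, rfl, rfl, rfl⟩ := lift_eq φ ψ χ
    simp only [pull_add, add_assoc]
  zero_add φ := by
    obtain ⟨T, a, b, c, rfl, -, -⟩ := lift_eq φ φ φ
    rw [pull_zero T, pull_add, zero_add]
  add_zero φ := by
    obtain ⟨T, a, b, c, rfl, -, -⟩ := lift_eq φ φ φ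
    rw [pull_zero T, pull_add, add_zero]
  add_comm φ ψ := by
    obtain ⟨T, a, b, c, rfl, rfl, -⟩ := lift_eq φ ψ φ
    rw [pull_add, pull_add, add_comm]
  neg_add_cancel φ := by
    obtain ⟨T, a, b, c, rfl, -, -⟩ := lift_eq φ φ φ
    rw [pull_zero T, pull_neg, pull_add, neg_add_cancel]
  mul_assoc φ ψ χ := by
    obtain ⟨T, a, b, c, rfl, rfl, rfl⟩ := lift_eq φ ψ χ
    simp only [pull_mul, mul_assoc]
  one_mul φ := by
    obtain ⟨T, a, b, c, rfl, -, -⟩ := lift_eq φ φ φ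
    rw [pull_one T, pull_mul, one_mul]
  mul_one φ := by
    obtain ⟨T, a, b, c, rfl, -, -⟩ := lift_eq φ φ φ
    rw [pull_one T, pull_mul, mul_one]
  mul_comm φ ψ := by
    obtain ⟨T, a, b, c, rfl, rfl, -⟩ := lift_eq φ ψ φ
    rw [pull_mul, pull_mul, mul_comm]
  left_distrib φ ψ χ := by
    obtain ⟨T, a, b, c, rfl, rfl, rfl⟩ := lift_eq φ ψ χ
    simp only [pull_mul, pull_add, mul_add]
  right_distrib φ ψ χ := by
    obtain ⟨T, a, b, c, rfl, rfl, rfl⟩ := lift_eq φ ψ χ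
    simp only [pull_mul, pull_add, add_mul]
  zero_mul φ := by
    obtain ⟨T, a, b, c, rfl, -, -⟩ := lift_eq φ φ φ
    rw [pull_zero T, pull_mul, zero_mul]
  mul_zero φ := by
    obtain ⟨T, a, b, c, rfl, -, -⟩ := lift_eq φ φ φ
    rw [pull_zero T, pull_mul, mul_zero]
  nsmul := nsmulRec
  zsmul := zsmulRec

end RL

/-! ### Cozero elements, `P_F`-frames and `d`-ideals -/

/-- The cozero element of `φ`: the join of all `φ(p, 0) ∨ φ(0, q)`. -/
def coz {L : Type u} [Order.Frame L] (φ : RL L) : L :=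
  ⨆ (p : ℚ) (q : ℚ), φ.toFun p 0 ⊔ φ.toFun 0 q

/-- The cozero part of `L`. -/
def Coz (L : Type u) [Order.Frame L] : Set L := Set.range (coz : RL L → L)

/-- `L` is a `P_F`-frame: of any two disjoint cozero elements, at least one is complemented. -/
def IsPFFrame (L : Type u) [Order.Frame L] : Prop :=
  ∀ a ∈ Coz L, ∀ b ∈ Coz L, a ⊓ b = ⊥ → IsComplemented a ∨ IsComplemented b

/-- `I` is a `d`-ideal of `ℛL`: if `f ∈ I` and `coz α ≤ (coz f)**`, then `α ∈ I`.  In a frame, `aᶜ`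
is the pseudocomplement of `a`. -/
def IsDIdeal {L : Type u} [Order.Frame L] (I : Ideal (RL L)) : Prop :=
  ∀ α : RL L, ∀ f ∈ I, coz α ≤ (coz f)ᶜᶜ → α ∈ I

end PointfreeReal

/-!
Every element of `ℛL` is the image of a continuous function under a ring homomorphism
`C(X, ℝ) → ℛL` induced by a frame homomorphism `Opens X → L`, so that pointwise constructions
(odd roots, quotients, minima) transfer to `ℛL`. In particular `coz φ` is complemented iff
`φ ^ 2 ∣ φ`.

If `L` is a `P_F`-frame, then for `φ`, `ψ` and `μ = min (φ ^ 2) (ψ ^ 2)`, which is divisible by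
both, one of the disjoint cozero elements of `φ ^ 2 - μ` and `ψ ^ 2 - μ` is complemented. The
corresponding idempotent splits `ℛL` into a factor where `φ` (say) is invertible and one where
`φ ^ 2` is a multiple of `ψ`. Membership in a sum or an intersection of two ideals can be
decided separately on the two factors.

Conversely, if the ideal generated by `φ` and some elements annihilated by `φ` is a `d`-ideal,
then it contains the cube root of `φ`, which makes `coz φ` complemented. For disjoint `coz φ` and
`coz ψ`, (3) applied to the principal ideals of `φ` and `ψ` thus shows that one of the cozero
elements is complemented. For (1) one enlarges the principal ideals to ideals with the same sum as
two `d`-ideals annihilated by `ψ` and by `φ`, respectively. To keep this sum proper, `φ` is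
replaced by a multiple `φ * κ` that vanishes on a nonzero cozero element below `coz φ`.
-/

namespace PointfreeReal

open RL

theorem isComplemented_of_inf_of_sup_eq_top {D : Type*} [DistribLattice D] [BoundedOrder D]
    {a b : D} (hinf : IsComplemented (a ⊓ b)) (hsup : a ⊔ b = ⊤) : IsComplemented a := by
  obtain ⟨c, hc⟩ := hinf
  refine ⟨b ⊓ c, IsCompl.of_eq ((inf_assoc a b c).symm.trans hc.inf_eq_bot) ?_⟩
  rw [sup_inf_left, hsup, top_inf_eq, eq_top_iff, ← hc.sup_eq_top]
  exact sup_le_sup_right inf_le_left c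

section ContinuousFunctions

variable {X : Type*} [TopologicalSpace X]

theorem dvd_of_abs_le_sq {a b : C(X, ℝ)} (h : ∀ x, |b x| ≤ a x ^ 2) : a ∣ b := by
  have hquot : ∀ x, |b x / a x| ≤ |a x| := fun x => by
    rw [abs_div]
    exact div_le_of_le_mul₀ (abs_nonneg _) (abs_nonneg _) (by simpa [← sq] using h x)
  have hcont : Continuous fun x => b x / a x := by
    refine continuous_iff_continuousAt.2 fun x => ?_
    by_cases hx : a x = 0
    · rw [ContinuousAt, hx, div_zero]
      refine squeeze_zero_norm hquot ?_
      simpa [hx] using (a.continuous.abs).tendsto x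
    · exact b.continuous.continuousAt.div a.continuous.continuousAt hx
  refine ⟨⟨_, hcont⟩, ContinuousMap.ext fun x => ?_⟩
  by_cases hx : a x = 0
  · simpa [hx] using h x
  · exact (mul_div_cancel₀ (b x) hx).symm

theorem exists_continuousMap_pow_eq {n : ℕ} (hn : Odd n) (a : C(X, ℝ)) :
    ∃ b : C(X, ℝ), b ^ n = a := by
  have hsurj : Function.Surjective fun x : ℝ => x ^ n := fun y => by
    rcases le_total 0 y with hy | hy
    · exact ⟨_, Real.rpow_inv_natCast_pow hy hn.pos.ne'⟩
    · refine ⟨-(-y) ^ (n⁻¹ : ℝ), ?_⟩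
      simp only [hn.neg_pow, Real.rpow_inv_natCast_pow (neg_nonneg.2 hy) hn.pos.ne', neg_neg]
  let powIso : ℝ ≃o ℝ := hn.strictMono_pow.orderIsoOfSurjective _ hsurj
  exact ⟨⟨fun x => powIso.symm (a x), powIso.symm.continuous.comp a.continuous⟩,
    ContinuousMap.ext fun x => powIso.apply_symm_apply (a x)⟩

/-- The cozero set of a continuous real function as an open set: the spatial counterpart of
`coz`. -/
def cozeroSet (a : C(X, ℝ)) : Opens X := ⟨Function.support a, a.continuous.isOpen_support⟩

theorem mem_cozeroSet {a : C(X, ℝ)} {x : X} : x ∈ cozeroSet a ↔ a x ≠ 0 := Iff.rfl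

theorem cozeroSet_id_eq_iSup_ival :
    cozeroSet (ContinuousMap.id ℝ) = ⨆ (p : ℚ) (q : ℚ), (ival p 0 ⊔ ival 0 q) := by
  ext x
  simp only [SetLike.mem_coe, mem_cozeroSet, ContinuousMap.id_apply, Opens.mem_iSup, Opens.mem_sup,
    mem_ival, Rat.cast_zero]
  constructor
  · intro hx
    obtain ⟨p, hp⟩ := exists_rat_lt x
    obtain ⟨q, hq⟩ := exists_rat_gt x
    exact ⟨p, q, hx.lt_or_gt.imp (⟨hp, ·⟩) (⟨·, hq⟩)⟩
  · rintro ⟨p, q, h | h⟩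
    exacts [h.2.ne, h.1.ne']

end ContinuousFunctions

variable {L : Type*} [Order.Frame L]

section FrameHoms

variable {X Y : Type*} [TopologicalSpace X] [TopologicalSpace Y]

/-- The factorization of a frame homomorphism on `Opens X` through the open subspace `Y`, which
exists if the homomorphism maps that subspace to the top element. -/
def liftOpenEmbedding (T : FrameHom (Opens X) L) {e : Y → X} (he : Topology.IsOpenEmbedding e)
    (hT : T ⟨Set.range e, he.isOpen_range⟩ = ⊤) : FrameHom (Opens Y) L where
  toFun V := T ⟨e '' V, he.isOpenMap _ V.isOpen⟩
  map_inf' U V := by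
    rw [← map_inf]
    exact congrArg T (Opens.ext (Set.image_inter he.injective))
  map_top' := by
    rw [← hT]
    exact congrArg T (Opens.ext Set.image_univ)
  map_sSup' S := by
    rw [← Set.image_image T, ← map_sSup]
    refine congrArg T (Opens.ext ?_)
    simp only [Opens.coe_mk, Opens.coe_sSup, Set.image_iUnion, Set.biUnion_image]

/-- The frame homomorphism given by a partition of the top element indexed by the points of `X`. -/
def partitionHom (c : X → L) (hdisj : Pairwise (Function.onFun Disjoint c)) (htop : ⨆ x, c x = ⊤) :
    FrameHom (Opens X) L where
  toFun U := ⨆ x ∈ U, c x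
  map_inf' U V := by
    refine le_antisymm (le_inf (biSup_mono fun _ h => h.1) (biSup_mono fun _ h => h.2)) ?_
    simp only [iSup_inf_eq, inf_iSup_eq]
    refine iSup₂_le fun x hx => iSup₂_le fun y hy => ?_
    rcases eq_or_ne x y with rfl | hxy
    · exact inf_le_left.trans (le_iSup₂_of_le x ⟨hy, hx⟩ le_rfl)
    · exact ((hdisj hxy.symm).le_bot).trans bot_le
  map_top' := by simpa using htop
  map_sSup' S := by
    refine le_antisymm (iSup₂_le fun x hx => ?_) (sSup_le ?_)
    · obtain ⟨U, hU, hxU⟩ := Opens.mem_sSup.1 hx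
      exact le_sSup_of_le ⟨U, hU, rfl⟩ (le_iSup₂_of_le x hxU le_rfl)
    · rintro _ ⟨U, hU, rfl⟩
      exact biSup_mono fun x hx => Opens.mem_sSup.2 ⟨U, hU, hx⟩

end FrameHoms

section PullHom

variable {X Y : Type} [TopologicalSpace X] [TopologicalSpace Y]

/-- The ring homomorphism `C(X, ℝ) → ℛL` induced by a frame homomorphism `Opens X → L`: it allows
computing in `ℛL` pointwise. -/
def pullHom (T : FrameHom (Opens X) L) : C(X, ℝ) →+* RL L where
  toFun a := ofHom (T.comp (Opens.comap a))
  map_one' := (pull_one T).symm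
  map_mul' a b := (pull_mul T a b).symm
  map_zero' := (pull_zero T).symm
  map_add' a b := (pull_add T a b).symm

theorem pullHom_toFun (T : FrameHom (Opens X) L) (a : C(X, ℝ)) (p q : ℚ) :
    (pullHom T a).toFun p q = T (Opens.comap a (ival p q)) := rfl

theorem exists_pullHom (φ : RL L) :
    ∃ (T : FrameHom (Opens ℝ) L) (a : C(ℝ, ℝ)), pullHom T a = φ :=
  ⟨φ.toHom, ContinuousMap.id ℝ, ofHom_toHom φ⟩

theorem exists_pullHom₂ (φ ψ : RL L) :
    ∃ (T : FrameHom (Opens (ℝ × ℝ)) L) (a b : C(ℝ × ℝ, ℝ)), pullHom T a = φ ∧ pullHom T b = ψ := by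
  refine ⟨pair φ.toHom ψ.toHom, ⟨Prod.fst, continuous_fst⟩, ⟨Prod.snd, continuous_snd⟩, ?_, ?_⟩
  · exact (congrArg ofHom (pair_fst φ.toHom ψ.toHom)).trans (ofHom_toHom φ)
  · exact (congrArg ofHom (pair_snd φ.toHom ψ.toHom)).trans (ofHom_toHom ψ)

theorem pullHom_liftOpenEmbedding (T : FrameHom (Opens X) L) {e : Y → X}
    (he : Topology.IsOpenEmbedding e) (hT : T ⟨Set.range e, he.isOpen_range⟩ = ⊤) (a : C(X, ℝ)) :
    pullHom (liftOpenEmbedding T he hT) (a.comp ⟨e, he.continuous⟩) = pullHom T a := by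
  ext p q
  rw [pullHom_toFun, pullHom_toFun, ← inf_top_eq (T (Opens.comap a _)), ← hT, ← map_inf]
  refine congrArg T (Opens.ext ?_)
  exact Set.image_preimage_eq_inter_range (f := e) (t := Opens.comap a (ival p q))

theorem coz_pullHom (T : FrameHom (Opens X) L) (a : C(X, ℝ)) :
    coz (pullHom T a) = T (cozeroSet a) := by
  change _ = (T.comp (Opens.comap a)) (cozeroSet (ContinuousMap.id ℝ))
  simp only [cozeroSet_id_eq_iSup_ival, map_iSup, map_sup]
  rfl

end PullHom

section Coz

variable {φ ψ α : RL L}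

theorem coz_zero : coz (0 : RL L) = ⊥ := by
  obtain ⟨T, -⟩ := exists_pullHom (0 : RL L)
  rw [← map_zero (pullHom T), coz_pullHom, ← map_bot T]
  exact congrArg T (Opens.ext Function.support_zero)

theorem coz_one : coz (1 : RL L) = ⊤ := by
  obtain ⟨T, -⟩ := exists_pullHom (1 : RL L)
  rw [← map_one (pullHom T), coz_pullHom, ← map_top T]
  exact congrArg T (Opens.ext (Function.support_one (R := ℝ)))

theorem coz_mul (φ ψ : RL L) : coz (φ * ψ) = coz φ ⊓ coz ψ := by
  obtain ⟨T, a, b, rfl, rfl⟩ := exists_pullHom₂ φ ψ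
  rw [← map_mul, coz_pullHom, coz_pullHom, coz_pullHom, ← map_inf]
  exact congrArg T (Opens.ext (Function.support_mul a b))

theorem coz_add_le (φ ψ : RL L) : coz (φ + ψ) ≤ coz φ ⊔ coz ψ := by
  obtain ⟨T, a, b, rfl, rfl⟩ := exists_pullHom₂ φ ψ
  rw [← map_add, coz_pullHom, coz_pullHom, coz_pullHom, ← map_sup]
  exact OrderHomClass.mono T (Function.support_add a b)

theorem coz_pow (φ : RL L) {n : ℕ} (hn : n ≠ 0) : coz (φ ^ n) = coz φ := by
  obtain ⟨T, a, rfl⟩ := exists_pullHom φ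
  rw [← map_pow, coz_pullHom, coz_pullHom]
  exact congrArg T (Opens.ext (Function.support_pow a hn))

theorem coz_le_of_dvd (h : φ ∣ ψ) : coz ψ ≤ coz φ := by
  obtain ⟨χ, rfl⟩ := h
  exact (coz_mul φ χ).trans_le inf_le_left

theorem coz_eq_bot_iff : coz φ = ⊥ ↔ φ = 0 := by
  refine ⟨fun h => ?_, fun h => h ▸ coz_zero⟩
  obtain ⟨T, a, rfl⟩ := exists_pullHom φ
  rw [coz_pullHom] at h
  have le_of_le_sup_cozeroSet {U V : Opens ℝ} (hUV : U ≤ V ⊔ cozeroSet a) : T U ≤ T V := by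
    simpa only [map_sup, h, sup_bot_eq] using OrderHomClass.mono T hUV
  have mem_comap_iff {x : ℝ} (hx : a x = 0) (p q : ℚ) :
      x ∈ Opens.comap a (ival p q) ↔ x ∈ Opens.comap (0 : C(ℝ, ℝ)) (ival p q) := by
    simp only [Opens.mem_comap, hx, ContinuousMap.zero_apply]
  rw [← map_zero (pullHom T)]
  ext p q
  refine le_antisymm (le_of_le_sup_cozeroSet fun x hx => ?_) (le_of_le_sup_cozeroSet fun x hx => ?_)
  · exact or_iff_not_imp_right.2 fun hax => (mem_comap_iff (not_not.1 hax) p q).1 hx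
  · exact or_iff_not_imp_right.2 fun hax => (mem_comap_iff (not_not.1 hax) p q).2 hx

instance : IsReduced (RL L) where
  eq_zero φ := by
    rintro ⟨n, hn⟩
    have hpow : φ ^ (n + 1) = 0 := by rw [pow_succ, hn, zero_mul]
    rw [← coz_eq_bot_iff, ← coz_pow φ n.succ_ne_zero, hpow, coz_zero]

theorem mul_eq_zero_iff_disjoint_coz : φ * ψ = 0 ↔ Disjoint (coz φ) (coz ψ) := by
  rw [← coz_eq_bot_iff, coz_mul, disjoint_iff]

theorem coz_add_of_mul_eq_zero (h : φ * ψ = 0) : coz (φ + ψ) = coz φ ⊔ coz ψ := by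
  refine le_antisymm (coz_add_le φ ψ) (sup_le ?_ ?_)
  · rw [← coz_pow φ two_ne_zero]
    exact coz_le_of_dvd ⟨φ, by linear_combination -h⟩
  · rw [← coz_pow ψ two_ne_zero]
    exact coz_le_of_dvd ⟨ψ, by linear_combination -h⟩

theorem isUnit_iff_coz_eq_top : IsUnit φ ↔ coz φ = ⊤ := by
  constructor
  · intro h
    rw [eq_top_iff, ← coz_one]
    exact coz_le_of_dvd h.dvd
  · intro h
    obtain ⟨T, a, rfl⟩ := exists_pullHom φ
    have he : Topology.IsOpenEmbedding ((↑) : cozeroSet a → ℝ) := (cozeroSet a).isOpenEmbedding'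
    rw [coz_pullHom] at h
    rw [← pullHom_liftOpenEmbedding T he (by simpa using h) a]
    exact ((ContinuousMap.isUnit_iff_forall_ne_zero _).2 fun x => x.2).map _

theorem exists_pow_eq {n : ℕ} (hn : Odd n) (φ : RL L) : ∃ ψ : RL L, ψ ^ n = φ := by
  obtain ⟨T, a, rfl⟩ := exists_pullHom φ
  obtain ⟨b, rfl⟩ := exists_continuousMap_pow_eq hn a
  exact ⟨pullHom T b, (map_pow _ _ _).symm⟩

theorem exists_dvd_dvd_sq_sub_mul_sq_sub_eq_zero (φ ψ : RL L) :
    ∃ μ : RL L, φ ∣ μ ∧ ψ ∣ μ ∧ (φ ^ 2 - μ) * (ψ ^ 2 - μ) = 0 := by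
  obtain ⟨T, a, b, rfl, rfl⟩ := exists_pullHom₂ φ ψ
  have abs_min_sq (x : ℝ × ℝ) : |min (a x ^ 2) (b x ^ 2)| = min (a x ^ 2) (b x ^ 2) :=
    abs_of_nonneg (by positivity)
  refine ⟨pullHom T (a ^ 2 ⊓ b ^ 2), map_dvd _ (dvd_of_abs_le_sq fun x => ?_),
    map_dvd _ (dvd_of_abs_le_sq fun x => ?_), ?_⟩
  · exact (abs_min_sq x).trans_le (min_le_left _ _)
  · exact (abs_min_sq x).trans_le (min_le_right _ _)
  · simp only [← map_pow, ← map_sub, ← map_mul]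
    rw [← map_zero (pullHom T)]
    refine congrArg _ (ContinuousMap.ext fun x => ?_)
    rcases le_total (a x ^ 2) (b x ^ 2) with h | h <;> simp [h]

theorem exists_ne_zero_mul_eq_zero_coz_sup_eq_top (h : φ ≠ 0) :
    ∃ η κ : RL L, η ≠ 0 ∧ η * κ = 0 ∧ coz φ ⊔ coz κ = ⊤ := by
  obtain ⟨T, a, rfl⟩ := exists_pullHom φ
  let above (n : ℕ) : C(ℝ, ℝ) := (a ^ 2 - .const ℝ (1 / (n + 1 : ℝ))) ⊔ 0
  let below (n : ℕ) : C(ℝ, ℝ) := (.const ℝ (1 / (n + 1 : ℝ)) - a ^ 2) ⊔ 0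
  obtain ⟨n, hn⟩ : ∃ n, pullHom T (above n) ≠ 0 := by
    by_contra! habove
    have hcover : cozeroSet a ≤ ⨆ n, cozeroSet (above n) := fun x hx => by
      obtain ⟨n, hn⟩ := exists_nat_one_div_lt (pow_pos (abs_pos.2 hx) 2)
      rw [sq_abs] at hn
      exact Opens.mem_iSup.2 ⟨n, (lt_max_of_lt_left (sub_pos.2 hn)).ne'⟩
    refine h (coz_eq_bot_iff.1 (le_bot_iff.1 ?_))
    calc coz (pullHom T a) ≤ T (⨆ n, cozeroSet (above n)) :=
          (coz_pullHom T a).trans_le (OrderHomClass.mono T hcover)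
      _ = ⊥ := by simp only [map_iSup, ← coz_pullHom, habove, coz_zero, iSup_bot]
  refine ⟨pullHom T (above n), pullHom T (below n), hn, ?_, ?_⟩
  · rw [← map_mul, ← map_zero (pullHom T)]
    refine congrArg _ (ContinuousMap.ext fun x => ?_)
    rcases le_total (a x ^ 2) (1 / (n + 1 : ℝ)) with hx | hx
    · exact mul_eq_zero_of_left (max_eq_right (sub_nonpos.2 hx)) _
    · exact mul_eq_zero_of_right _ (max_eq_right (sub_nonpos.2 hx))
  · rw [coz_pullHom, coz_pullHom, ← map_sup, ← map_top T]
    refine congrArg T (eq_top_iff.2 fun x _ => or_iff_not_imp_left.2 fun hx => ?_)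
    have hax : a x = 0 := not_not.1 hx
    refine (lt_max_of_lt_left (sub_pos.2 ?_)).ne'
    simpa [hax] using Nat.cast_add_one_pos (α := ℝ) n

theorem mem_Coz_of_isComplemented {c : L} (hc : IsComplemented c) : c ∈ Coz L := by
  obtain ⟨d, hcd⟩ := hc
  let T : FrameHom (Opens Bool) L := partitionHom (cond · c d)
    (pairwise_disjoint_on_bool.2 hcd.disjoint) (iSup_bool_eq.trans hcd.sup_eq_top)
  let indicator : C(Bool, ℝ) := ⟨(cond · 1 0), continuous_of_discreteTopology⟩
  refine ⟨pullHom T indicator, (coz_pullHom T indicator).trans ?_⟩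
  change ⨆ x ∈ cozeroSet indicator, cond x c d = c
  simp [iSup_bool_eq, mem_cozeroSet, indicator]

theorem isComplemented_coz_iff_sq_dvd : IsComplemented (coz φ) ↔ φ ^ 2 ∣ φ := by
  constructor
  · rintro ⟨d, hd⟩
    obtain ⟨δ, rfl⟩ := mem_Coz_of_isComplemented ⟨coz φ, hd.symm⟩
    have hφδ : φ * δ = 0 := mul_eq_zero_iff_disjoint_coz.2 hd.disjoint
    have hunit : IsUnit (φ + δ) :=
      isUnit_iff_coz_eq_top.2 ((coz_add_of_mul_eq_zero hφδ).trans hd.sup_eq_top)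
    have hsq : φ ^ 2 = φ * (φ + δ) := by linear_combination -hφδ
    rw [hsq]
    exact hunit.mul_right_dvd.2 dvd_rfl
  · rintro ⟨υ, hυ⟩
    have hdisj : φ * (1 - φ * υ) = 0 := by linear_combination hυ
    refine ⟨coz (1 - φ * υ), mul_eq_zero_iff_disjoint_coz.1 hdisj, codisjoint_iff.2 ?_⟩
    have hφ : coz (φ * υ) = coz φ :=
      (coz_le_of_dvd ⟨υ, rfl⟩).antisymm (coz_le_of_dvd ⟨φ, by linear_combination hυ⟩)
    rw [← hφ, ← coz_add_of_mul_eq_zero (by linear_combination υ * hdisj), add_sub_cancel, coz_one]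

theorem dvd_of_coz_le_compl_compl (hφ : IsComplemented (coz φ)) (h : coz α ≤ (coz φ)ᶜᶜ) :
    φ ∣ α := by
  obtain ⟨υ, hυ⟩ := isComplemented_coz_iff_sq_dvd.1 hφ
  have hdisj : φ * (1 - φ * υ) = 0 := by linear_combination hυ
  have hα : α * (1 - φ * υ) = 0 := mul_eq_zero_iff_disjoint_coz.2 <|
    disjoint_compl_left.mono h
      (le_compl_iff_disjoint_left.2 (mul_eq_zero_iff_disjoint_coz.1 hdisj))
  exact ⟨α * υ, by linear_combination hα⟩

theorem coz_mul_le_compl_compl (h : coz α ≤ (coz φ)ᶜᶜ) (ψ : RL L) :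
    coz (α * ψ) ≤ (coz (φ * ψ))ᶜᶜ := by
  rw [coz_mul, coz_mul, compl_compl_inf_distrib]
  exact inf_le_inf h le_compl_compl

end Coz

section Rings

variable {R : Type*} [CommRing R]

theorem sq_dvd_self_of_pow_succ_dvd_pow [IsReduced R] {x : R} {n : ℕ}
    (h : x ^ (n + 1) ∣ x ^ n) : x ^ 2 ∣ x := by
  obtain ⟨y, hy⟩ := h
  have hnil : (x * (1 - x * y)) ^ (n + 1) = 0 := by
    rw [mul_pow]
    linear_combination (x * (1 - x * y) ^ n) * hy
  exact ⟨y, by linear_combination eq_zero_of_pow_eq_zero hnil⟩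

/-- `x ^ 2` is a multiple of `y` up to a direct factor of the ring, split off by an idempotent `e`,
on which `x` is invertible. Over a `P_F`-frame any two elements of `ℛL` are comparable in this
sense. -/
def SqDominated (x y : R) : Prop :=
  ∃ e : R, IsIdempotentElem e ∧ x ∣ e ∧ y ∣ x ^ 2 * (1 - e)

theorem sqDominated_of_sq_dvd {x y m : R} (hx : x ∣ m) (hy : y ∣ m)
    (h : (x ^ 2 - m) ^ 2 ∣ x ^ 2 - m) : SqDominated x y := by
  obtain ⟨z, hz⟩ := h
  refine ⟨(x ^ 2 - m) * z, ?_, ?_, ?_⟩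
  · rw [IsIdempotentElem]
    linear_combination -z * hz
  · exact (dvd_sub (dvd_pow_self x two_ne_zero) hx).mul_right z
  · have hm : x ^ 2 * (1 - (x ^ 2 - m) * z) = m * (1 - (x ^ 2 - m) * z) := by
      linear_combination hz
    exact hm ▸ hy.mul_right _

theorem mem_of_mul_mem_of_mul_one_sub_mem {I : Ideal R} {x e : R} (he : x * e ∈ I)
    (he' : x * (1 - e) ∈ I) : x ∈ I := by
  simpa only [← mul_add, add_sub_cancel, mul_one] using I.add_mem he he'

theorem exists_idempotent_mem_of_sqDominated {I J : Ideal R} {x y z : R} (hx : x ∈ I) (hy : y ∈ J)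
    (hz : z ∈ J) (h : SqDominated x z) :
    ∃ e ∈ I, IsIdempotentElem e ∧ (x + y) ^ 3 * (1 - e) ∈ J := by
  obtain ⟨e, he, hxe, hze⟩ := h
  refine ⟨e, I.mem_of_dvd hxe hx, he, ?_⟩
  have hexpand : (x + y) ^ 3 * (1 - e) =
      x * (x ^ 2 * (1 - e)) + (1 - e) * (3 * x ^ 2 + 3 * x * y + y ^ 2) * y := by ring
  rw [hexpand]
  exact J.add_mem (J.mul_mem_left _ (J.mem_of_dvd hze hz)) (J.mul_mem_left _ hy)

theorem exists_idempotent_cube_mul_mem (hR : ∀ x y : R, SqDominated x y ∨ SqDominated y x)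
    {I J : Ideal R} {x y : R} (hx : x ∈ I + J) (hy : y ∈ I + J) :
    ∃ e : R, IsIdempotentElem e ∧ x ^ 3 * e ∈ I ∧ y ^ 3 * (1 - e) ∈ J := by
  obtain ⟨x₁, hx₁, x₂, hx₂, rfl⟩ := Submodule.mem_sup.1 hx
  obtain ⟨y₁, hy₁, y₂, hy₂, rfl⟩ := Submodule.mem_sup.1 hy
  rcases hR y₁ x₂ with h | h
  · obtain ⟨e, heI, he, hyJ⟩ := exists_idempotent_mem_of_sqDominated hy₁ hy₂ hx₂ h
    exact ⟨e, he, I.mul_mem_left _ heI, hyJ⟩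
  · obtain ⟨e, heJ, he, hxI⟩ := exists_idempotent_mem_of_sqDominated hx₂ hx₁ hy₁ h
    refine ⟨1 - e, he.one_sub, add_comm x₁ x₂ ▸ hxI, ?_⟩
    rw [sub_sub_cancel]
    exact J.mul_mem_left _ heJ

theorem span_singleton_sup_add_sup_span_singleton {I J : Ideal R} {x y : R} (hx : x ∈ I)
    (hy : y ∈ J) : (Ideal.span {x} ⊔ J) + (I ⊔ Ideal.span {y}) = I + J := by
  have hxI : Ideal.span {x} ⊔ I = I := sup_eq_right.2 ((Ideal.span_singleton_le_iff_mem I).2 hx)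
  have hyJ : J ⊔ Ideal.span {y} = J := sup_eq_left.2 ((Ideal.span_singleton_le_iff_mem J).2 hy)
  rw [Submodule.add_eq_sup, Submodule.add_eq_sup, sup_sup_sup_comm, hxI, hyJ]

end Rings

section DIdeals

variable {I J : Ideal (RL L)} {φ ψ α β : RL L}

theorem IsDIdeal.mem_of_pow_mem (hI : IsDIdeal I) {n : ℕ} (hn : n ≠ 0) (h : φ ^ n ∈ I) : φ ∈ I :=
  hI φ _ h ((coz_pow φ hn).symm ▸ le_compl_compl)

theorem isDIdeal_bot : IsDIdeal (⊥ : Ideal (RL L)) := by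
  rintro α _ rfl hα
  rwa [coz_zero, compl_bot, compl_top, le_bot_iff, coz_eq_bot_iff] at hα

/-- The ideal of all elements of `ℛL` whose cozero element is below `a`. -/
def cozIdeal (a : L) : Ideal (RL L) where
  carrier := {φ | coz φ ≤ a}
  add_mem' h h' := (coz_add_le _ _).trans (sup_le h h')
  zero_mem' := coz_zero.trans_le bot_le
  smul_mem' χ _ h := (coz_le_of_dvd (dvd_mul_left _ χ)).trans h

theorem mem_cozIdeal {a : L} : φ ∈ cozIdeal a ↔ coz φ ≤ a := Iff.rfl

theorem isDIdeal_cozIdeal {a : L} (ha : Heyting.IsRegular a) : IsDIdeal (cozIdeal a) :=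
  fun _ _ hφ h => h.trans ((compl_le_compl (compl_le_compl hφ)).trans_eq ha)

theorem mul_eq_zero_of_mem_cozIdeal {a : L} (hφ : Disjoint (coz φ) a) (hψ : ψ ∈ cozIdeal a) :
    φ * ψ = 0 :=
  mul_eq_zero_iff_disjoint_coz.2 (hφ.mono_right hψ)

theorem cozIdeal_add_cozIdeal_ne_top {a b c : L} (ha : a ≤ c) (hb : b ≤ c) (hc : c ≠ ⊤) :
    cozIdeal a + cozIdeal b ≠ ⊤ := by
  intro h
  have hone : (1 : RL L) ∈ cozIdeal c :=
    sup_le (c := cozIdeal c) (fun _ h => le_trans h ha) (fun _ h => le_trans h hb)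
      ((Ideal.eq_top_iff_one _).1 h)
  rw [mem_cozIdeal, coz_one, top_le_iff] at hone
  exact hc hone

theorem mem_of_isDIdeal_inf_of_sqDominated (hIJ : IsDIdeal (I ⊓ J)) (hφ : φ ∈ I) (hψ : ψ ∈ J)
    (hα : coz α ≤ (coz φ)ᶜᶜ) (h : SqDominated φ ψ) : α ∈ I := by
  obtain ⟨ε, -, hφε, hψε⟩ := h
  refine mem_of_mul_mem_of_mul_one_sub_mem (I.mul_mem_left _ (I.mem_of_dvd hφε hφ)) ?_
  have hmem : φ ^ 2 * (1 - ε) ∈ I ⊓ J :=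
    ⟨I.mul_mem_right _ (I.pow_mem_of_mem hφ 2 two_pos), J.mem_of_dvd hψε hψ⟩
  refine (hIJ _ _ hmem (coz_mul_le_compl_compl ?_ _)).1
  rwa [coz_pow φ two_ne_zero]

theorem IsDIdeal.mem_add_of_sqDominated (hJ : IsDIdeal J) (hφ : φ ∈ I) (hψ : ψ ∈ J)
    (hα : coz α ≤ (coz (φ + ψ))ᶜᶜ) (h : SqDominated φ ψ) : α ∈ I + J := by
  obtain ⟨ε, -, hφε, hψε⟩ := h
  have hcoz : coz ((φ + ψ) * (1 - ε)) ≤ coz ψ := by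
    rw [add_mul]
    refine (coz_add_le _ _).trans (sup_le ?_ (coz_le_of_dvd ⟨_, rfl⟩))
    rw [coz_mul, ← coz_pow φ two_ne_zero, ← coz_mul]
    exact coz_le_of_dvd hψε
  refine mem_of_mul_mem_of_mul_one_sub_mem
    (Submodule.mem_sup_left (I.mul_mem_left _ (I.mem_of_dvd hφε hφ)))
    (Submodule.mem_sup_right (hJ _ _ hψ ?_))
  exact (coz_mul_le_compl_compl hα _).trans (compl_le_compl (compl_le_compl hcoz))

theorem isDIdeal_or_isDIdeal_of_forall (h : ∀ φ ∈ I, ∀ ψ ∈ J, ∀ α β : RL L,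
    coz α ≤ (coz φ)ᶜᶜ → coz β ≤ (coz ψ)ᶜᶜ → α ∈ I ∨ β ∈ J) : IsDIdeal I ∨ IsDIdeal J := by
  by_contra! hn
  simp only [IsDIdeal, not_forall] at hn
  obtain ⟨⟨α, φ, hφ, hα, hαI⟩, β, ψ, hψ, hβ, hβJ⟩ := hn
  exact (h φ hφ ψ hψ α β hα hβ).elim hαI hβJ

end DIdeals

namespace IsPFFrame

variable {I J : Ideal (RL L)}

theorem sqDominated_or (hL : IsPFFrame L) (φ ψ : RL L) : SqDominated φ ψ ∨ SqDominated ψ φ := by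
  obtain ⟨μ, hφ, hψ, hμ⟩ := exists_dvd_dvd_sq_sub_mul_sq_sub_eq_zero φ ψ
  refine (hL _ ⟨_, rfl⟩ _ ⟨_, rfl⟩ (mul_eq_zero_iff_disjoint_coz.1 hμ).eq_bot).imp ?_ ?_
  · exact fun h => sqDominated_of_sq_dvd hφ hψ (isComplemented_coz_iff_sq_dvd.1 h)
  · exact fun h => sqDominated_of_sq_dvd hψ hφ (isComplemented_coz_iff_sq_dvd.1 h)

theorem isDIdeal_or_of_inf (hL : IsPFFrame L) (hIJ : IsDIdeal (I ⊓ J)) :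
    IsDIdeal I ∨ IsDIdeal J :=
  isDIdeal_or_isDIdeal_of_forall fun φ hφ ψ hψ _ _ hα hβ => (hL.sqDominated_or φ ψ).imp
    (mem_of_isDIdeal_inf_of_sqDominated hIJ hφ hψ hα)
    (mem_of_isDIdeal_inf_of_sqDominated (inf_comm I J ▸ hIJ) hψ hφ hβ)

theorem isDIdeal_add (hL : IsPFFrame L) (hI : IsDIdeal I) (hJ : IsDIdeal J) :
    IsDIdeal (I + J) := by
  intro α χ hχ hα
  obtain ⟨φ, hφ, ψ, hψ, rfl⟩ := Submodule.mem_sup.1 hχ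
  rcases hL.sqDominated_or φ ψ with h | h
  · exact hJ.mem_add_of_sqDominated hφ hψ hα h
  · rw [add_comm φ ψ] at hα
    exact add_comm I J ▸ hI.mem_add_of_sqDominated hψ hφ hα h

theorem mem_or_mem_of_idempotent (hL : IsPFFrame L) {φ ψ α β ε : RL L} (hφ : φ ∈ I) (hψ : ψ ∈ J)
    (hα : coz α ≤ (coz φ)ᶜᶜ) (hβ : coz β ≤ (coz ψ)ᶜᶜ) (hε : IsIdempotentElem ε)
    (hαε : α * ε ∈ I) (hβε : β * (1 - ε) ∈ J) : α ∈ I ∨ β ∈ J := by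
  have hdisj : Disjoint (coz (φ * (1 - ε))) (coz (ψ * ε)) :=
    mul_eq_zero_iff_disjoint_coz.1 (by linear_combination φ * ψ * hε.one_sub_mul_self)
  rcases hL _ ⟨_, rfl⟩ _ ⟨_, rfl⟩ hdisj.eq_bot with hc | hc
  · refine .inl (mem_of_mul_mem_of_mul_one_sub_mem hαε ?_)
    exact I.mem_of_dvd (dvd_of_coz_le_compl_compl hc (coz_mul_le_compl_compl hα _))
      (I.mul_mem_right _ hφ)
  · refine .inr (mem_of_mul_mem_of_mul_one_sub_mem ?_ hβε)
    exact J.mem_of_dvd (dvd_of_coz_le_compl_compl hc (coz_mul_le_compl_compl hβ _))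
      (J.mul_mem_right _ hψ)

theorem isDIdeal_or_of_add (hL : IsPFFrame L) (hIJ : IsDIdeal (I + J)) :
    IsDIdeal I ∨ IsDIdeal J := by
  refine isDIdeal_or_isDIdeal_of_forall fun φ hφ ψ hψ α β hα hβ => ?_
  obtain ⟨ρ, rfl⟩ := exists_pow_eq (n := 3) (by decide) α
  obtain ⟨σ, rfl⟩ := exists_pow_eq (n := 3) (by decide) β
  have hρ : ρ ∈ I + J :=
    hIJ.mem_of_pow_mem three_ne_zero (hIJ _ _ (Submodule.mem_sup_left hφ) hα)
  have hσ : σ ∈ I + J :=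
    hIJ.mem_of_pow_mem three_ne_zero (hIJ _ _ (Submodule.mem_sup_right hψ) hβ)
  obtain ⟨ε, hε, hρε, hσε⟩ := exists_idempotent_cube_mul_mem hL.sqDominated_or hρ hσ
  exact hL.mem_or_mem_of_idempotent hφ hψ hα hβ hε hρε hσε

end IsPFFrame

section Converse

variable {φ ψ κ η : RL L}

theorem isComplemented_coz_of_isDIdeal_span_sup {K : Ideal (RL L)} (hK : ∀ χ ∈ K, φ * χ = 0)
    (h : IsDIdeal (Ideal.span {φ} ⊔ K)) : IsComplemented (coz φ) := by
  obtain ⟨ρ, rfl⟩ := exists_pow_eq (n := 3) (by decide) φ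
  have hρ : ρ ∈ Ideal.span {ρ ^ 3} ⊔ K := h.mem_of_pow_mem three_ne_zero
    (Submodule.mem_sup_left (Ideal.mem_span_singleton_self _))
  obtain ⟨υ, χ, hχ, hsum⟩ := Ideal.mem_span_singleton_sup.1 hρ
  rw [coz_pow ρ three_ne_zero, isComplemented_coz_iff_sq_dvd]
  refine sq_dvd_self_of_pow_succ_dvd_pow (n := 4) ⟨ρ * υ, ?_⟩
  linear_combination hK χ hχ - ρ ^ 3 * hsum

theorem isPFFrame_of_inf (h : ∀ I J : Ideal (RL L), IsDIdeal (I ⊓ J) → IsDIdeal I ∨ IsDIdeal J) :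
    IsPFFrame L := by
  rintro _ ⟨φ, rfl⟩ _ ⟨ψ, rfl⟩ hφψ
  have hinf : Ideal.span {φ} ⊓ Ideal.span {ψ} = (⊥ : Ideal (RL L)) := by
    refine eq_bot_iff.2 fun χ ⟨hφχ, hψχ⟩ => coz_eq_bot_iff.1 (le_bot_iff.1 ?_)
    rw [← hφψ]
    exact le_inf (coz_le_of_dvd (Ideal.mem_span_singleton.1 hφχ))
      (coz_le_of_dvd (Ideal.mem_span_singleton.1 hψχ))
  have isComplemented_of_span (χ : RL L) (hχ : IsDIdeal (Ideal.span {χ})) :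
      IsComplemented (coz χ) :=
    isComplemented_coz_of_isDIdeal_span_sup (K := ⊥) (by simp) (by rwa [sup_bot_eq])
  exact (h _ _ (hinf ▸ isDIdeal_bot)).imp (isComplemented_of_span φ) (isComplemented_of_span ψ)

theorem isComplemented_coz_or_of_isDIdeal_cozIdeal_add
    (h : ∀ I J : Ideal (RL L), IsDIdeal (I + J) → I + J ≠ ⊤ → IsDIdeal I ∨ IsDIdeal J) {a b : L}
    (hab : Disjoint a b) (hφ : coz φ ≤ a) (hψ : coz ψ ≤ b)
    (hd : IsDIdeal (cozIdeal a + cozIdeal b)) (htop : cozIdeal a + cozIdeal b ≠ ⊤) :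
    IsComplemented (coz φ) ∨ IsComplemented (coz ψ) := by
  rw [← span_singleton_sup_add_sup_span_singleton (mem_cozIdeal.2 hφ) (mem_cozIdeal.2 hψ)]
    at hd htop
  refine (h _ _ hd htop).imp ?_ fun hJ => ?_
  · exact isComplemented_coz_of_isDIdeal_span_sup fun _ =>
      mul_eq_zero_of_mem_cozIdeal (hab.mono_left hφ)
  · rw [sup_comm] at hJ
    exact isComplemented_coz_of_isDIdeal_span_sup
      (fun _ => mul_eq_zero_of_mem_cozIdeal (hab.mono_right hψ).symm) hJ

theorem isPFFrame_of_add
    (hadd : ∀ I J : Ideal (RL L), IsDIdeal I → IsDIdeal J → IsDIdeal (I + J) ∨ I + J = ⊤)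
    (hor : ∀ I J : Ideal (RL L), IsDIdeal (I + J) → I + J ≠ ⊤ → IsDIdeal I ∨ IsDIdeal J) :
    IsPFFrame L := by
  rintro _ ⟨φ, rfl⟩ _ ⟨ψ, rfl⟩ hφψ
  rcases eq_or_ne φ 0 with rfl | hφ
  · exact .inl (coz_zero (L := L) ▸ isComplemented_bot)
  have hdisj : Disjoint (coz φ) (coz ψ) := disjoint_iff.2 hφψ
  obtain ⟨η, κ, hη, hηκ, hφκ⟩ := exists_ne_zero_mul_eq_zero_coz_sup_eq_top hφ
  have hκη : coz κ ≤ (coz η)ᶜ :=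
    le_compl_iff_disjoint_left.2 (mul_eq_zero_iff_disjoint_coz.1 hηκ)
  have hηφ : coz η ≤ coz φ :=
    (mul_eq_zero_iff_disjoint_coz.1 hηκ).left_le_of_le_sup_right (hφκ ▸ le_top)
  have hψη : (coz ψ)ᶜᶜ ≤ (coz η)ᶜ :=
    compl_le_compl (hηφ.trans (le_compl_iff_disjoint_right.2 hdisj))
  let a : L := (coz φ)ᶜᶜ ⊓ (coz η)ᶜ
  have ha : IsDIdeal (cozIdeal a) :=
    isDIdeal_cozIdeal ((Heyting.isRegular_compl _).inf (Heyting.isRegular_compl _))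
  have hab : Disjoint a (coz ψ)ᶜᶜ :=
    (disjoint_compl_compl_left_iff.2 (disjoint_compl_compl_right_iff.2 hdisj)).mono_left inf_le_left
  have htop : cozIdeal a + cozIdeal (coz ψ)ᶜᶜ ≠ ⊤ :=
    cozIdeal_add_cozIdeal_ne_top inf_le_right hψη fun h =>
      hη (coz_eq_bot_iff.1 (disjoint_top.1 (h ▸ disjoint_compl_right)))
  have hd : IsDIdeal (cozIdeal a + cozIdeal (coz ψ)ᶜᶜ) :=
    (hadd _ _ ha (isDIdeal_cozIdeal (Heyting.isRegular_compl _))).resolve_right htop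
  have hφκa : coz (φ * κ) ≤ a := (coz_mul φ κ).trans_le (inf_le_inf le_compl_compl hκη)
  exact (isComplemented_coz_or_of_isDIdeal_cozIdeal_add hor hab hφκa le_compl_compl hd
    htop).imp_left fun hc => isComplemented_of_inf_of_sup_eq_top (coz_mul φ κ ▸ hc) hφκ

end Converse

end PointfreeReal

theorem mainTheorem4_general {L : Type*} [Order.Frame L] :
    List.TFAE [
      (∀ I J : Ideal (PointfreeReal.RL L), PointfreeReal.IsDIdeal I → PointfreeReal.IsDIdeal J →
          PointfreeReal.IsDIdeal (I + J) ∨ I + J = ⊤) ∧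
        (∀ I J : Ideal (PointfreeReal.RL L), PointfreeReal.IsDIdeal (I + J) → I + J ≠ ⊤ →
          PointfreeReal.IsDIdeal I ∨ PointfreeReal.IsDIdeal J),
      PointfreeReal.IsPFFrame L,
      ∀ I J : Ideal (PointfreeReal.RL L), PointfreeReal.IsDIdeal (I ⊓ J) →
        PointfreeReal.IsDIdeal I ∨ PointfreeReal.IsDIdeal J] := by
  tfae_have 1 → 2 := fun h => PointfreeReal.isPFFrame_of_add h.1 h.2
  tfae_have 2 → 1 := fun hL => ⟨fun _ _ hI hJ => .inl (hL.isDIdeal_add hI hJ),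
    fun _ _ hIJ _ => hL.isDIdeal_or_of_add hIJ⟩
  tfae_have 2 → 3 := fun hL _ _ => hL.isDIdeal_or_of_inf
  tfae_have 3 → 2 := PointfreeReal.isPFFrame_of_inf
  tfae_finish

theorem mainTheorem4 {L : Type*} [Order.Frame L] (hL : PointfreeReal.IsCompletelyRegular L) :
    List.TFAE [
      (∀ I J : Ideal (PointfreeReal.RL L), PointfreeReal.IsDIdeal I → PointfreeReal.IsDIdeal J →
          PointfreeReal.IsDIdeal (I + J) ∨ I + J = ⊤) ∧
        (∀ I J : Ideal (PointfreeReal.RL L), PointfreeReal.IsDIdeal (I + J) → I + J ≠ ⊤ →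
          PointfreeReal.IsDIdeal I ∨ PointfreeReal.IsDIdeal J),
      PointfreeReal.IsPFFrame L,
      ∀ I J : Ideal (PointfreeReal.RL L), PointfreeReal.IsDIdeal (I ⊓ J) →
        PointfreeReal.IsDIdeal I ∨ PointfreeReal.IsDIdeal J] :=
  mainTheorem4_general
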